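/- Let $X$ and $Y$ be Banach spaces (both real or both complex), with $X$ separable and reflexive. Let $\mathcal L$ be a collection (more generally, an indexed family) of bounded linear operators $L : X \to Y$, equipped with a $\sigma$-compact locally compact Hausdorff topology such that for every $x \in X$ the map $\mathcal L \to Y$, $L \mapsto Lx$, is continuous for the norm of $Y$. Put $$M = M(X,\mathcal L) = \Big\{x \in X : \sup_{L\in\mathcal L} \|Lx\|_Y < \infty\Big\}, \qquad \|x\|_M = \sup_{L\in\mathcal L}\|Lx\|_Y,$$ $$M_0 = M_0(X,\mathcal L) = \Big\{x \in M : \limsup_{\mathcal L\ni L\to\infty} \|Lx\|_Y = 0\Big\},$$ where $L\to\infty$ is understood in the one-point compactification of $\mathcal L$. Suppose that $M$ is dense in $X$ and that $\|\cdot\|_M$ is a norm making $M$ a Banach space continuously contained in $X$; give $M_0$ the norm of $M$. Assume that for every $x\in M$ there is a sequence $(x_n)$ in $M_0$ with $x_n\to x$ in $X$ and $\sup_n\|x_n\|_M<\infty$. Then $X^*$ is continuously contained and dense in $M_0^*$, that is, the restriction map $J : X^*\to M_0^*$, $Jx^* = x^*|_{M_0}$, is bounded, injective and has dense range. Let $I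 = J^* : M_0^{**}\to X^{**} = X$ be the adjoint of $J$. Then $I$ is a continuous isomorphism (with continuous inverse) of $M_0^{**}$ onto $M$, where $M$ carries the norm $\|\cdot\|_M$, and $I$ acts as the identity on $M_0\subset M_0^{**}$. If moreover for every $x\in M$ there is a sequence $(x_n)$ in $M_0$ with $x_n\to x$ in $X$ and $\sup_n\|x_n\|_M\le\|x\|_M$, then $I : M_0^{**}\to M$ is an isometry. -/

import Mathlib

open Set Filter Topology

noncomputable section

namespace BigLittle

section Spaces

variable {𝕜 : Type*} [RCLike 𝕜]
  {X : Type*} [NormedAddCommGroup X] [NormedSpace 𝕜 X]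
  {Y : Type*} [NormedAddCommGroup Y] [NormedSpace 𝕜 Y]
  {Λ : Type*}

/-- The subspace of all `x : X` for which the values `‖L x‖` are bounded, where `L` runs through
the family `T` of bounded operators. -/
def bigSubmodule (T : Λ → X →L[𝕜] Y) : Submodule 𝕜 X where
  carrier := {x | BddAbove (range fun l => ‖T l x‖)}
  add_mem' := by
    rintro x y ⟨a, ha⟩ ⟨b, hb⟩
    refine ⟨a + b, ?_⟩
    rintro _ ⟨l, rfl⟩
    simp only [map_add]
    exact (norm_add_le _ _).trans (add_le_add (ha ⟨l, rfl⟩) (hb ⟨l, rfl⟩))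
  zero_mem' := ⟨0, by rintro _ ⟨l, rfl⟩; simp⟩
  smul_mem' := by
    rintro c x ⟨a, ha⟩
    refine ⟨‖c‖ * a, ?_⟩
    rintro _ ⟨l, rfl⟩
    simp only [map_smul, norm_smul]
    exact mul_le_mul_of_nonneg_left (ha ⟨l, rfl⟩) (norm_nonneg c)

/-- The big space `M`. It is a type of its own because it carries the norm `sup_L ‖L x‖`
and not the norm of `X`. -/
def BigSpace (T : Λ → X →L[𝕜] Y) : Type _ := ↥(bigSubmodule T)

variable (T : Λ → X →L[𝕜] Y)

instance : AddCommGroup (BigSpace T) := inferInstanceAs (AddCommGroup ↥(bigSubmodule T))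

instance : Module 𝕜 (BigSpace T) := inferInstanceAs (Module 𝕜 ↥(bigSubmodule T))

/-- The inclusion of the big space into `X`, as a linear map. -/
def incl : BigSpace T →ₗ[𝕜] X := (bigSubmodule T).subtype

variable {T}

theorem incl_injective : Function.Injective (incl T) := Subtype.val_injective

theorem bddAbove_big (x : BigSpace T) : BddAbove (range fun l => ‖T l (incl T x)‖) := x.2

variable (T)

/-- The norm of the big space is `sup_L ‖L x‖`. -/
instance : Norm (BigSpace T) := ⟨fun x => ⨆ l, ‖T l (incl T x)‖⟩

theorem norm_big_def (x : BigSpace T) : ‖x‖ = ⨆ l, ‖T l (incl T x)‖ := rfl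

theorem seminormedCore_big : SeminormedSpace.Core 𝕜 (BigSpace T) where
  norm_nonneg x := Real.iSup_nonneg fun _ => norm_nonneg _
  norm_smul c x := by
    simp only [norm_big_def, map_smul, norm_smul]
    exact (Real.mul_iSup_of_nonneg (norm_nonneg c) _).symm
  norm_triangle x y := by
    simp only [norm_big_def]
    refine Real.iSup_le (fun l => ?_)
      (add_nonneg (Real.iSup_nonneg fun _ => norm_nonneg _)
        (Real.iSup_nonneg fun _ => norm_nonneg _))
    rw [map_add, map_add]
    exact (norm_add_le _ _).trans
      (add_le_add (le_ciSup (bddAbove_big x) l) (le_ciSup (bddAbove_big y) l))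

/-- In general `sup_L ‖L x‖` is a seminorm on the big space; it is a norm as soon as the
inclusion into `X` is continuous for it. -/
instance : SeminormedAddCommGroup (BigSpace T) :=
  SeminormedAddCommGroup.ofCore (seminormedCore_big T)

instance : NormedSpace 𝕜 (BigSpace T) where
  norm_smul_le c x := ((seminormedCore_big T).norm_smul c x).le

variable [TopologicalSpace Λ]

/-- The little space `M₀`: those `x` in the big space for which `‖L x‖ → 0` as `L → ∞` in the
(Hausdorff, locally compact) index space, that is, along the filter of complements of compact
sets. It carries the norm of the big space. -/
def littleSpace : Submodule 𝕜 (BigSpace T) where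
  carrier := {x | Tendsto (fun l => ‖T l (incl T x)‖) (cocompact Λ) (𝓝 0)}
  add_mem' := by
    intro x y hx hy
    have h := Tendsto.add hx hy
    rw [add_zero] at h
    refine squeeze_zero (fun _ => norm_nonneg _) (fun l => ?_) h
    rw [map_add, map_add]
    exact norm_add_le _ _
  zero_mem' := by simp [tendsto_const_nhds]
  smul_mem' := by
    intro c x hx
    have h := Tendsto.const_mul ‖c‖ hx
    rw [mul_zero] at h
    refine h.congr fun l => ?_
    rw [map_smul, map_smul, norm_smul]

/-- Every element of `M` is the limit in `X` of a sequence in `M₀` that is bounded in the norm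
of `M`. -/
def BoundedApprox : Prop :=
  ∀ x : BigSpace T, ∃ u : ℕ → littleSpace T,
    Tendsto (fun n => incl T (u n)) atTop (𝓝 (incl T x)) ∧ BddAbove (range fun n => ‖u n‖)

/-- Every element `x` of `M` is the limit in `X` of a sequence in `M₀` whose members have
`M`-norm at most that of `x`. -/
def ContractiveApprox : Prop :=
  ∀ x : BigSpace T, ∃ u : ℕ → littleSpace T,
    Tendsto (fun n => incl T (u n)) atTop (𝓝 (incl T x)) ∧ ∀ n, ‖u n‖ ≤ ‖x‖

variable {T}

/-- The bounded inclusion of `M₀` into `X`, when `M` is continuously contained in `X`. -/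
def littleIncl (hM : Continuous (incl T)) : littleSpace T →L[𝕜] X :=
  (⟨incl T, hM⟩ : BigSpace T →L[𝕜] X).comp (littleSpace T).subtypeL

/-- The map `J : X* → M₀*` that restricts a functional to `M₀`. -/
def J (hM : Continuous (incl T)) : StrongDual 𝕜 X →L[𝕜] StrongDual 𝕜 (littleSpace T) :=
  ContinuousLinearMap.precomp 𝕜 (littleIncl hM)

/-- The adjoint `I : M₀** → X** = X` of `J`, for reflexive `X`. -/
def I (hX : Function.Surjective (NormedSpace.inclusionInDoubleDualLi 𝕜 (E := X)))
    (hM : Continuous (incl T)) :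
    StrongDual 𝕜 (StrongDual 𝕜 (littleSpace T)) →L[𝕜] X :=
  ((LinearIsometryEquiv.ofSurjective
      (NormedSpace.inclusionInDoubleDualLi 𝕜 (E := X)) hX).symm.toContinuousLinearEquiv :
      StrongDual 𝕜 (StrongDual 𝕜 X) →L[𝕜] X).comp
    (ContinuousLinearMap.precomp 𝕜 (J hM))

end Spaces

end BigLittle

end

namespace BigLittle

open scoped ZeroAtInfty

/-! The map `x ↦ (L ↦ L x)` embeds `M₀` isometrically in `C₀(Λ, Y)`, so a functional on `M₀` extends
to some `Φ` there. Such a `Φ` is, up to small norm, carried by a compact set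
(`exists_cutoff_norm_le`), and on a compact set of indices `L x` is controlled by the norm of `X`
(`exists_truncation`). Hence `X*` is dense in `M₀*` (`denseRange_J`) and `I` is injective. Testing
`L (I m)` against `Y*` shows that `I` maps into `M` without increasing norms (`norm_apply_I_le`).
Conversely, if a sequence in `M₀` bounded by `C` tends to `x` in `X`, then `J f ↦ f x` is bounded by
`C`, and a Hahn–Banach extension of it is a preimage of `x` of norm at most `C`. The open mapping
theorem concludes; `C = ‖x‖` gives the isometry. -/

/-- Hahn–Banach extension along an injective linear map. -/
theorem exists_extension_of_norm_le {𝕜 E F : Type*} [RCLike 𝕜] [AddCommGroup E] [Module 𝕜 E]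
    [SeminormedAddCommGroup F] [NormedSpace 𝕜 F] (f : E →ₗ[𝕜] F) (hf : Function.Injective f)
    (φ : E →ₗ[𝕜] 𝕜) {C : ℝ} (hC : 0 ≤ C) (h : ∀ x, ‖φ x‖ ≤ C * ‖f x‖) :
    ∃ ψ : StrongDual 𝕜 F, ‖ψ‖ ≤ C ∧ ∀ x, ψ (f x) = φ x := by
  let e := LinearEquiv.ofInjective f hf
  have he : ∀ y : LinearMap.range f, ‖(φ ∘ₗ e.symm.toLinearMap) y‖ ≤ C * ‖y‖ := by
    intro y
    obtain ⟨x, rfl⟩ := e.surjective y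
    simpa [e] using h x
  obtain ⟨ψ, hψ, hn⟩ := exists_extension_norm_eq (LinearMap.range f)
    (LinearMap.mkContinuous (φ ∘ₗ e.symm.toLinearMap) C he)
  refine ⟨ψ, hn ▸ LinearMap.mkContinuous_norm_le _ hC _, fun x => ?_⟩
  have := hψ (e x)
  simpa [e] using this

/-! ### Functionals on duals, and isomorphisms out of biduals -/

section Bidual

variable {𝕜 E : Type*} [RCLike 𝕜] [SeminormedAddCommGroup E] [NormedSpace 𝕜 E]

theorem norm_bidual_apply_le (m : StrongDual 𝕜 (StrongDual 𝕜 E)) (f : StrongDual 𝕜 E) {C : ℝ}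
    (hC : 0 ≤ C) (h : ∀ x, ‖f x‖ ≤ C * ‖x‖) : ‖m f‖ ≤ ‖m‖ * C :=
  m.le_opNorm_of_le (f.opNorm_le_bound hC h)

/-- If `x` is a limit of the images of a sequence in the ball of radius `C` of `E`, then evaluation
at `x` factors through a functional of norm at most `C` on the dual of `E`. -/
theorem exists_bidual_of_tendsto {X : Type*} [NormedAddCommGroup X] [NormedSpace 𝕜 X]
    (ι : E →L[𝕜] X) (hι : Function.Injective fun f : StrongDual 𝕜 X => f.comp ι) {x : X}
    {u : ℕ → E} (hu : Tendsto (fun n => ι (u n)) atTop (𝓝 x)) {C : ℝ} (hC : ∀ n, ‖u n‖ ≤ C) :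
    ∃ m : StrongDual 𝕜 (StrongDual 𝕜 E), ‖m‖ ≤ C ∧ ∀ f : StrongDual 𝕜 X, m (f.comp ι) = f x := by
  -- By `hι`, `f ∘ ι ↦ f x` is well defined; `‖f x‖ = lim ‖f (ι (u n))‖ ≤ C * ‖f ∘ ι‖` bounds it.
  refine exists_extension_of_norm_le (ContinuousLinearMap.precomp 𝕜 ι).toLinearMap hι
    (NormedSpace.inclusionInDoubleDual 𝕜 X x).toLinearMap ((norm_nonneg _).trans (hC 0))
    fun f => ?_
  refine le_of_tendsto ((f.continuous.tendsto x).comp hu).norm (Eventually.of_forall fun n => ?_)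
  rw [mul_comm]
  exact (f.comp ι).le_opNorm_of_le (hC n)

/-- A bounded linear bijection between Banach spaces, whose norms need only be given as seminorms
that separate points, is an isomorphism. -/
theorem exists_continuousLinearEquiv_of_bijective {D B : Type*} [SeminormedAddCommGroup D]
    [NormedSpace 𝕜 D] [CompleteSpace D] [SeminormedAddCommGroup B] [NormedSpace 𝕜 B]
    [CompleteSpace B] (hD : ∀ x : D, ‖x‖ = 0 → x = 0) (hB : ∀ x : B, ‖x‖ = 0 → x = 0) (F : D →ₗ[𝕜] B)
    (hF : Function.Bijective F) (hc : Continuous F) : ∃ Φ : D ≃L[𝕜] B, ∀ m, Φ m = F m := by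
  have hs : Continuous (LinearEquiv.ofBijective F hF).symm := by
    let : NormedAddCommGroup D := NormedAddCommGroup.ofSeparation hD
    let : NormedAddCommGroup B := NormedAddCommGroup.ofSeparation hB
    exact LinearEquiv.continuous_symm (LinearEquiv.ofBijective F hF) hc
  exact ⟨{ LinearEquiv.ofBijective F hF with
      continuous_toFun := hc
      continuous_invFun := hs }, fun _ => rfl⟩

/-- A contractive linear bijection from a bidual onto a Banach space is an isomorphism. -/
theorem exists_bidual_equiv {B : Type*} [SeminormedAddCommGroup B] [NormedSpace 𝕜 B]
    [CompleteSpace B] (hB : ∀ x : B, ‖x‖ = 0 → x = 0)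
    (F : StrongDual 𝕜 (StrongDual 𝕜 E) →ₗ[𝕜] B) (hF : Function.Bijective F)
    (hn : ∀ m, ‖F m‖ ≤ ‖m‖) :
    ∃ Φ : StrongDual 𝕜 (StrongDual 𝕜 E) ≃L[𝕜] B, ∀ m, Φ m = F m := by
  have hD (m : StrongDual 𝕜 (StrongDual 𝕜 E)) (hm : ‖m‖ = 0) : m = 0 := by
    ext f
    refine norm_le_zero_iff.1 ((m.le_opNorm f).trans_eq ?_)
    rw [hm, zero_mul]
  have hc : Continuous F :=
    AddMonoidHomClass.continuous_of_bound F 1 fun m => by rw [one_mul]; exact hn m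
  exact @exists_continuousLinearEquiv_of_bijective 𝕜 _ (StrongDual 𝕜 (StrongDual 𝕜 E)) B
    ContinuousLinearMap.toSeminormedAddCommGroup ContinuousLinearMap.toNormedSpace inferInstance
    _ _ _ hD hB F hF hc

end Bidual

/-! ### Functionals on `C₀(Λ, Y)` and compact cutoffs -/

section Functionals

variable {𝕜 : Type*} [RCLike 𝕜] {Y : Type*} [NormedAddCommGroup Y] [NormedSpace 𝕜 Y]
  {Λ : Type*} [TopologicalSpace Λ]

theorem norm_apply_le_zeroAtInfty (f : C₀(Λ, Y)) (l : Λ) : ‖f l‖ ≤ ‖f‖ :=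
  BoundedContinuousFunction.norm_coe_le_norm f.toBCF l

theorem norm_zeroAtInfty_le {f : C₀(Λ, Y)} {C : ℝ} (hC : 0 ≤ C) (h : ∀ l, ‖f l‖ ≤ C) :
    ‖f‖ ≤ C :=
  (BoundedContinuousFunction.norm_le (f := f.toBCF) hC).2 h

/-- A bounded functional on `C₀(Λ, Y)` is small on functions supported off a large compact set. -/
theorem exists_cutoff_norm_le [T2Space Λ] [LocallyCompactSpace Λ]
    (Φ : StrongDual 𝕜 C₀(Λ, Y)) {ε : ℝ} (hε : 0 < ε) :
    ∃ χ : C(Λ, ℝ), HasCompactSupport χ ∧ (∀ l, χ l ∈ Icc (0 : ℝ) 1) ∧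
      ∀ g h : C₀(Λ, Y), (∀ l, h l = g l - (χ l : 𝕜) • g l) → ‖Φ h‖ ≤ ε * ‖g‖ := by
  -- A nearly norming `f` in the unit ball is below `δ` off a compact `K`, while `h` vanishes on
  -- `K`. Adding `h` to `‖g‖ • f` thus barely raises the sup norm, so `Φ h` must be small or `Φ`
  -- would exceed its norm.
  obtain ⟨f, hf, hfΦ⟩ := Φ.exists_lt_apply_of_lt_opNorm (sub_lt_self ‖Φ‖ (half_pos hε))
  set δ : ℝ := ε / (2 * (‖Φ‖ + 1)) with hδ
  have hδ0 : 0 < δ := by positivity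
  have hδε : ‖Φ‖ * δ ≤ ε / 2 := by
    rw [hδ, mul_div_assoc', div_le_div_iff₀ (by positivity) two_pos]
    nlinarith [norm_nonneg Φ]
  have hsmall : ∀ᶠ l in cocompact Λ, ‖f l‖ < δ := by
    have := (zero_at_infty f).norm
    rw [norm_zero] at this
    exact this.eventually (gt_mem_nhds hδ0)
  obtain ⟨K, hK, hKf⟩ := mem_cocompact.1 hsmall
  obtain ⟨χ, hχ1, -, hχc, hχ⟩ :=
    exists_continuous_one_zero_of_isCompact hK isClosed_empty (disjoint_empty K)
  refine ⟨χ, hχc, hχ, fun g h hgh => ?_⟩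
  -- The unimodular `a` and `b` align the phases, so that the two values of `Φ` add up.
  obtain ⟨a, ha, haf⟩ := RCLike.exists_norm_eq_mul_self (Φ f)
  obtain ⟨b, hb, hbh⟩ := RCLike.exists_norm_eq_mul_self (Φ h)
  have hnorm : ‖((‖g‖ : 𝕜) * a) • f + b • h‖ ≤ ‖g‖ * (1 + δ) := by
    refine norm_zeroAtInfty_le (by positivity) fun l => ?_
    have h1 : ‖(((‖g‖ : 𝕜) * a) • f + b • h) l‖ ≤ ‖g‖ * ‖f l‖ + ‖h l‖ := by
      refine (norm_add_le _ _).trans_eq ?_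
      simp [norm_smul, ha, hb]
    refine h1.trans ?_
    by_cases hl : l ∈ K
    · have : h l = 0 := by rw [hgh, hχ1 hl]; simp
      rw [this, norm_zero, add_zero]
      refine mul_le_mul_of_nonneg_left ?_ (norm_nonneg g)
      linarith [norm_apply_le_zeroAtInfty f l]
    · have h2 : ‖f l‖ < δ := hKf hl
      have h3 : ‖h l‖ ≤ ‖g‖ := by
        have h4 : h l = ((1 - χ l : ℝ) : 𝕜) • g l := by
          rw [hgh]; push_cast; rw [sub_smul, one_smul]
        rw [h4, norm_smul, RCLike.norm_ofReal, abs_of_nonneg (by linarith [(hχ l).2])]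
        refine (mul_le_of_le_one_left (norm_nonneg _) (by linarith [(hχ l).1])).trans ?_
        exact norm_apply_le_zeroAtInfty g l
      nlinarith [norm_nonneg g]
  have hval : Φ (((‖g‖ : 𝕜) * a) • f + b • h) = ((‖g‖ * ‖Φ f‖ + ‖Φ h‖ : ℝ) : 𝕜) := by
    rw [map_add, map_smul, map_smul, smul_eq_mul, smul_eq_mul, mul_assoc, ← haf, ← hbh]
    push_cast
    rfl
  have hle := Φ.le_opNorm_of_le hnorm
  rw [hval, RCLike.norm_ofReal, abs_of_nonneg (by positivity)] at hle
  nlinarith [norm_nonneg g, norm_nonneg Φ]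

/-- The product of a continuous function with a compactly supported scalar function. -/
def cutoff (χ : C(Λ, ℝ)) (hχ : HasCompactSupport χ) (f : Λ → Y) (hf : Continuous f) :
    C₀(Λ, Y) where
  toFun l := (χ l : 𝕜) • f l
  continuous_toFun := (RCLike.continuous_ofReal.comp χ.continuous).smul hf
  zero_at_infty' := by
    refine HasCompactSupport.is_zero_at_infty (hχ.mono fun l hl => ?_)
    contrapose! hl
    simp [Function.notMem_support.1 hl]

theorem cutoff_apply (χ : C(Λ, ℝ)) (hχ : HasCompactSupport χ) (f : Λ → Y) (hf : Continuous f)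
    (l : Λ) : cutoff (𝕜 := 𝕜) χ hχ f hf l = (χ l : 𝕜) • f l := rfl

end Functionals

/-! ### The spaces `M` and `M₀` and the maps `J` and `I` -/

section Spaces

variable {𝕜 : Type*} [RCLike 𝕜]
  {X : Type*} [NormedAddCommGroup X] [NormedSpace 𝕜 X]
  {Y : Type*} [NormedAddCommGroup Y] [NormedSpace 𝕜 Y]
  {Λ : Type*} {T : Λ → X →L[𝕜] Y}

theorem norm_apply_le_big (x : BigSpace T) (l : Λ) : ‖T l (incl T x)‖ ≤ ‖x‖ :=
  le_ciSup (bddAbove_big x) l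

theorem norm_big_le {x : BigSpace T} {C : ℝ} (hC : 0 ≤ C) (h : ∀ l, ‖T l (incl T x)‖ ≤ C) :
    ‖x‖ ≤ C :=
  Real.iSup_le h hC

theorem exists_incl_eq {x : X} {C : ℝ} (h : ∀ l, ‖T l x‖ ≤ C) : ∃ y : BigSpace T, incl T y = x :=
  ⟨⟨x, C, by rintro _ ⟨l, rfl⟩; exact h l⟩, rfl⟩

theorem eq_zero_of_norm_big_eq_zero (hM : Continuous (incl T)) (x : BigSpace T) (hx : ‖x‖ = 0) :
    x = 0 := by
  have h : Inseparable x 0 := by rw [Metric.inseparable_iff, dist_zero_right, hx]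
  simpa using incl_injective ((h.map hM).eq.trans (map_zero _).symm)

theorem completeSpace_big [CompleteSpace X] (hM : Continuous (incl T)) :
    CompleteSpace (BigSpace T) := by
  refine Metric.complete_of_cauchySeq_tendsto fun u hu => ?_
  have hu' : CauchySeq fun n => incl T (u n) :=
    hu.map (⟨incl T, hM⟩ : BigSpace T →L[𝕜] X).uniformContinuous
  obtain ⟨x, hx⟩ := cauchySeq_tendsto_of_complete hu'
  -- The Cauchy estimate passes to the limit for each index separately, hence uniformly in `l`.
  have key : ∀ ε > 0, ∃ N, ∀ n ≥ N, ∀ l, ‖T l (x - incl T (u n))‖ ≤ ε := by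
    intro ε hε
    obtain ⟨N, hN⟩ := Metric.cauchySeq_iff.1 hu ε hε
    refine ⟨N, fun n hn l => ?_⟩
    have ht : Tendsto (fun m => ‖T l (incl T (u m) - incl T (u n))‖) atTop
        (𝓝 ‖T l (x - incl T (u n))‖) :=
      (((T l).continuous.tendsto _).comp (hx.sub_const _)).norm
    refine le_of_tendsto ht (eventually_atTop.2 ⟨N, fun m hm => ?_⟩)
    rw [← map_sub]
    refine (norm_apply_le_big _ l).trans ?_
    rw [← dist_eq_norm]
    exact (hN m hm n hn).le
  -- Since `x - u N` has bounded values it lies in `M`, and therefore so does `x`.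
  obtain ⟨N, hN⟩ := key 1 one_pos
  obtain ⟨z, hz⟩ := exists_incl_eq (hN N le_rfl)
  refine ⟨z + u N, Metric.tendsto_atTop'.2 fun ε hε => ?_⟩
  obtain ⟨N', hN'⟩ := key (ε / 2) (half_pos hε)
  refine ⟨N', fun n hn => ?_⟩
  rw [dist_comm, dist_eq_norm]
  refine (norm_big_le (half_pos hε).le fun l => ?_).trans_lt (half_lt_self hε)
  have : incl T (z + u N - u n) = x - incl T (u n) := by
    rw [map_sub, map_add, hz, sub_add_cancel]
  rw [this]
  exact hN' n hn.le l

variable [TopologicalSpace Λ]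

theorem denseRange_littleIncl (hM : Continuous (incl T)) (hdense : DenseRange (incl T))
    (happrox : BoundedApprox T) : DenseRange (littleIncl hM) := by
  refine dense_iff_closure_eq.2 (eq_univ_of_univ_subset ?_)
  rw [← hdense.closure_eq]
  refine closure_minimal ?_ isClosed_closure
  rintro _ ⟨x, rfl⟩
  obtain ⟨u, hu, -⟩ := happrox x
  exact mem_closure_of_tendsto hu (Eventually.of_forall fun n => ⟨u n, rfl⟩)

theorem J_injective (hM : Continuous (incl T)) (hdense : DenseRange (littleIncl hM)) :
    Function.Injective (J hM) := by
  intro f g hfg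
  refine DFunLike.coe_injective (hdense.equalizer f.continuous g.continuous (funext fun x => ?_))
  exact DFunLike.congr_fun hfg x

/-- The map `x ↦ (L ↦ L x)` from the little space to the continuous functions vanishing at
infinity. -/
def evalC₀ (hT : ∀ x : X, Continuous fun l => T l x) : littleSpace T →ₗ[𝕜] C₀(Λ, Y) where
  toFun x :=
    { toFun := fun l => T l (incl T x)
      continuous_toFun := hT _
      zero_at_infty' := tendsto_zero_iff_norm_tendsto_zero.2 x.2 }
  map_add' x y := by ext l; simp
  map_smul' c x := by ext l; simp

theorem evalC₀_apply (hT : ∀ x : X, Continuous fun l => T l x) (x : littleSpace T) (l : Λ) :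
    evalC₀ hT x l = T l (incl T x) := rfl

theorem norm_evalC₀ (hT : ∀ x : X, Continuous fun l => T l x) (x : littleSpace T) :
    ‖evalC₀ hT x‖ = ‖x‖ :=
  le_antisymm (norm_zeroAtInfty_le (norm_nonneg x) fun l => norm_apply_le_big (x : BigSpace T) l)
    (norm_big_le (norm_nonneg _) fun l => norm_apply_le_zeroAtInfty (evalC₀ hT x) l)

/-- Truncating `L ↦ L x` to a compact set of indices is a bounded operation on `X`. -/
theorem exists_truncation [CompleteSpace X] (hT : ∀ x : X, Continuous fun l => T l x)
    (χ : C(Λ, ℝ)) (hχ : HasCompactSupport χ) (hχ1 : ∀ l, χ l ∈ Icc (0 : ℝ) 1) :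
    ∃ S : X →L[𝕜] C₀(Λ, Y), ∀ x l, S x l = (χ l : 𝕜) • T l x := by
  -- Continuity of `l ↦ T l x` on the compact support gives the pointwise bounds.
  obtain ⟨C, hC⟩ := banach_steinhaus (g := fun l : tsupport χ => T l) fun x => by
    obtain ⟨C, hC⟩ := hχ.isCompact.exists_bound_of_continuousOn (hT x).continuousOn
    exact ⟨C, fun l => hC l l.2⟩
  let S : X →ₗ[𝕜] C₀(Λ, Y) :=
    { toFun := fun x => cutoff (𝕜 := 𝕜) χ hχ (fun l => T l x) (hT x)
      map_add' := fun x y => by ext l; simp [cutoff_apply]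
      map_smul' := fun c x => by
        ext l
        simp only [cutoff_apply, map_smul, ZeroAtInftyContinuousMap.smul_apply, RingHom.id_apply]
        exact smul_comm _ _ _ }
  -- If the support is empty, `C` may be negative.
  refine ⟨S.mkContinuous (max C 0) fun x => norm_zeroAtInfty_le (by positivity) fun l => ?_,
    fun x l => rfl⟩
  change ‖(χ l : 𝕜) • T l x‖ ≤ _
  by_cases hl : l ∈ tsupport χ
  · rw [norm_smul, RCLike.norm_ofReal, abs_of_nonneg (hχ1 l).1]
    refine (mul_le_of_le_one_left (norm_nonneg _) (hχ1 l).2).trans ?_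
    exact (T l).le_of_opNorm_le ((hC ⟨l, hl⟩).trans (le_max_left _ _)) x
  · rw [image_eq_zero_of_notMem_tsupport hl]
    simp only [RCLike.ofReal_zero, zero_smul, norm_zero]
    positivity

theorem denseRange_J [CompleteSpace X] [T2Space Λ] [LocallyCompactSpace Λ]
    (hT : ∀ x : X, Continuous fun l => T l x) (hM : Continuous (incl T)) :
    DenseRange (J hM) := by
  have hinj : Function.Injective (evalC₀ hT) := by
    refine (injective_iff_map_eq_zero _).2 fun x hx => Subtype.ext ?_
    refine eq_zero_of_norm_big_eq_zero hM _ ?_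
    rw [← norm_zero (E := C₀(Λ, Y)), ← hx, norm_evalC₀]
    rfl
  intro φ
  refine Metric.mem_closure_range_iff.2 fun ε hε => ?_
  obtain ⟨Φ, -, hΦ⟩ := exists_extension_of_norm_le (evalC₀ hT) hinj φ.toLinearMap (norm_nonneg φ)
    fun x => by rw [norm_evalC₀]; exact φ.le_opNorm x
  obtain ⟨χ, hχc, hχ, hχΦ⟩ := exists_cutoff_norm_le Φ (half_pos hε)
  obtain ⟨S, hS⟩ := exists_truncation hT χ hχc hχ
  -- `x ↦ Φ (χ • T x)` is bounded on all of `X` and differs from `φ` on `M₀` only by the tail of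
  -- `Φ`.
  refine ⟨Φ.comp S, ?_⟩
  rw [dist_eq_norm]
  refine (ContinuousLinearMap.opNorm_le_bound _ (half_pos hε).le fun x => ?_).trans_lt
    (half_lt_self hε)
  rw [← norm_evalC₀ hT]
  have := hχΦ (evalC₀ hT x) (evalC₀ hT x - S (incl T x)) fun l => by
    rw [ZeroAtInftyContinuousMap.sub_apply, hS, evalC₀_apply]
  rw [map_sub, hΦ] at this
  exact this

theorem dual_apply_I (hX : Function.Surjective (NormedSpace.inclusionInDoubleDualLi 𝕜 (E := X)))
    (hM : Continuous (incl T)) (m : StrongDual 𝕜 (StrongDual 𝕜 (littleSpace T)))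
    (f : StrongDual 𝕜 X) : f (I hX hM m) = m (J hM f) := by
  have h : NormedSpace.inclusionInDoubleDualLi 𝕜 (I hX hM m) = m.comp (J hM) :=
    (LinearIsometryEquiv.ofSurjective
      (NormedSpace.inclusionInDoubleDualLi 𝕜 (E := X)) hX).apply_symm_apply _
  exact DFunLike.congr_fun h f

theorem I_injective (hX : Function.Surjective (NormedSpace.inclusionInDoubleDualLi 𝕜 (E := X)))
    (hM : Continuous (incl T)) (hJ : DenseRange (J hM)) : Function.Injective (I hX hM) := by
  intro m m' h
  refine DFunLike.coe_injective (hJ.equalizer m.continuous m'.continuous (funext fun f => ?_))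
  simp only [Function.comp_apply, ← dual_apply_I hX hM, h]

/-- For `f` in `Y*`, the functional `f ∘ T l` restricted to `M₀` has norm at most `‖f‖`, because `‖T
l x‖` is at most the `M`-norm of `x`. -/
theorem norm_apply_I_le
    (hX : Function.Surjective (NormedSpace.inclusionInDoubleDualLi 𝕜 (E := X)))
    (hM : Continuous (incl T)) (m : StrongDual 𝕜 (StrongDual 𝕜 (littleSpace T))) (l : Λ) :
    ‖T l (I hX hM m)‖ ≤ ‖m‖ := by
  refine NormedSpace.norm_le_dual_bound 𝕜 _ (norm_nonneg m) fun f => ?_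
  have h := dual_apply_I hX hM m (f.comp (T l))
  rw [ContinuousLinearMap.comp_apply] at h
  rw [h]
  refine norm_bidual_apply_le m _ (norm_nonneg f) fun x => ?_
  exact f.le_opNorm_of_le (norm_apply_le_big (x : BigSpace T) l)

theorem I_inclusionInDoubleDual
    (hX : Function.Surjective (NormedSpace.inclusionInDoubleDualLi 𝕜 (E := X)))
    (hM : Continuous (incl T)) (x : littleSpace T) :
    I hX hM (NormedSpace.inclusionInDoubleDual 𝕜 (littleSpace T) x) = incl T x := by
  refine (SeparatingDual.eq_iff_forall_dual_eq (R := 𝕜)).2 fun f => ?_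
  rw [dual_apply_I]
  rfl

/-- The limit in `X` of a sequence bounded in `M₀` is in the range of `I`. -/
theorem exists_I_eq_of_tendsto
    (hX : Function.Surjective (NormedSpace.inclusionInDoubleDualLi 𝕜 (E := X)))
    (hM : Continuous (incl T)) (hJ : Function.Injective (J hM)) {x : X} {u : ℕ → littleSpace T}
    (hu : Tendsto (fun n => incl T (u n)) atTop (𝓝 x)) {C : ℝ} (hC : ∀ n, ‖u n‖ ≤ C) :
    ∃ m, I hX hM m = x ∧ ‖m‖ ≤ C := by
  obtain ⟨m, hm, hmJ⟩ := exists_bidual_of_tendsto (littleIncl hM) hJ hu hC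
  refine ⟨m, (SeparatingDual.eq_iff_forall_dual_eq (R := 𝕜)).2 fun f => ?_, hm⟩
  rw [dual_apply_I]
  exact hmJ f

end Spaces

end BigLittle

theorem theorem1 {𝕜 : Type*} [RCLike 𝕜]
    {X : Type*} [NormedAddCommGroup X] [NormedSpace 𝕜 X] [CompleteSpace X]
    [TopologicalSpace.SeparableSpace X]
    (hX : Function.Surjective (NormedSpace.inclusionInDoubleDualLi 𝕜 (E := X)))
    {Y : Type*} [NormedAddCommGroup Y] [NormedSpace 𝕜 Y] [CompleteSpace Y]
    {Λ : Type*} [TopologicalSpace Λ] [T2Space Λ] [LocallyCompactSpace Λ] [SigmaCompactSpace Λ]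
    (T : Λ → X →L[𝕜] Y) (hT : ∀ x : X, Continuous fun l => T l x)
    (hM : Continuous (BigLittle.incl T)) (hdense : DenseRange (BigLittle.incl T))
    (happrox : BigLittle.BoundedApprox T) :
    Function.Injective (BigLittle.J hM) ∧ DenseRange (BigLittle.J hM) ∧
    ∃ Φ : StrongDual 𝕜 (StrongDual 𝕜 (BigLittle.littleSpace T)) ≃L[𝕜] BigLittle.BigSpace T,
      (∀ m, BigLittle.incl T (Φ m) = BigLittle.I hX hM m) ∧
      (∀ x : BigLittle.littleSpace T,
        Φ (NormedSpace.inclusionInDoubleDual 𝕜 (BigLittle.littleSpace T) x) = x) ∧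
      (BigLittle.ContractiveApprox T → ∀ m, ‖Φ m‖ = ‖m‖) := by
  have hd := BigLittle.denseRange_littleIncl hM hdense happrox
  have hJ := BigLittle.J_injective hM hd
  have hJd := BigLittle.denseRange_J hT hM
  refine ⟨hJ, hJd, ?_⟩
  have : CompleteSpace (BigLittle.BigSpace T) := BigLittle.completeSpace_big hM
  choose F hF using fun m => BigLittle.exists_incl_eq (BigLittle.norm_apply_I_le hX hM m)
  have hFn : ∀ m, ‖F m‖ ≤ ‖m‖ := fun m =>
    BigLittle.norm_big_le (norm_nonneg m) fun l => by
      rw [hF]; exact BigLittle.norm_apply_I_le hX hM m l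
  let G : StrongDual 𝕜 (StrongDual 𝕜 (BigLittle.littleSpace T)) →ₗ[𝕜] BigLittle.BigSpace T :=
    { toFun := F
      map_add' := fun m m' => BigLittle.incl_injective (by simp [hF])
      map_smul' := fun c m => BigLittle.incl_injective (by simp [hF]) }
  have hGi : Function.Injective G := fun m m' h =>
    BigLittle.I_injective hX hM hJd (by rw [← hF, ← hF]; exact congrArg _ h)
  have hGs : Function.Surjective G := fun x => by
    obtain ⟨u, hu, C, hC⟩ := happrox x
    obtain ⟨m, hm, -⟩ := BigLittle.exists_I_eq_of_tendsto hX hM hJ hu fun n => hC ⟨n, rfl⟩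
    exact ⟨m, BigLittle.incl_injective ((hF m).trans hm)⟩
  obtain ⟨Φ, hΦ⟩ := BigLittle.exists_bidual_equiv (BigLittle.eq_zero_of_norm_big_eq_zero hM) G
    ⟨hGi, hGs⟩ hFn
  refine ⟨Φ, fun m => ?_, fun x => BigLittle.incl_injective ?_, fun hc m => ?_⟩
  · rw [hΦ]
    exact hF m
  · rw [hΦ]
    exact (hF _).trans (BigLittle.I_inclusionInDoubleDual hX hM x)
  · rw [hΦ]
    refine le_antisymm (hFn m) ?_
    obtain ⟨u, hu, hC⟩ := hc (F m)
    obtain ⟨m', hm', hn⟩ := BigLittle.exists_I_eq_of_tendsto hX hM hJ hu hC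
    rw [hF] at hm'
    -- Injectivity of `I` identifies the small preimage `m'` with `m` itself.
    rwa [BigLittle.I_injective hX hM hJd hm'] at hn
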